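/- For integers $n\ge 1$, $n_1,n_2\ge1$ and $z,z_1,z_2\in\{1,-1\}$ put $$\mathrm{Li}_n(z)=\sum_{k\ge 1}\frac{z^k}{k^n},\qquad \mathrm{Li}_{n_1,n_2}(z_1,z_2)=\lim_{N\to\infty}\sum_{0<k_1<k_2\le N}\frac{z_1^{k_1}z_2^{k_2}}{k_1^{n_1}k_2^{n_2}},$$ where the first series is understood as the limit of its partial sums and $(n,z)\neq(1,1)$, and set $\mathrm{Li}_0(\pm1)=-\tfrac12$. Let $n_1,n_2\ge 1$ be such that the weight $w=n_1+n_2$ is odd, and let $(z_1,z_2)\in\{1,-1\}^2$ with $(n_2,z_2)\ne(1,1)$. Then all limits above converge, and $$\mathrm{Li}_{n_1,n_2}(z_1,z_2)=(-1)^{n_1}\sum_{\substack{2s+k=w\\ s\ge 0,\ k\ge 1}}\mathrm{Li}_{2s}(z_1z_2)\left[\binom{k-1}{n_1-1}\mathrm{Li}_k(z_1)+\binom{k-1}{n_2-1}\mathrm{Li}_k(z_2)\right]-\tfrac12\mathrm{Li}_w(z_1z_2)+\delta_{n_2}\,\mathrm{Li}_{n_1}(z_1)\mathrm{Li}_{n_2}(z_2),$$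 where $\delta_{n_2}=1$ if $n_2$ is even and $\delta_{n_2}=0$ if $n_2$ is odd. Here the divergent symbol $\mathrm{Li}_1(1)$ may be given any complex value $c$: the formula holds for every choice of $c$ (that is, the total coefficient of $\mathrm{Li}_1(1)$ on the right-hand side vanishes). -/

import Mathlib

open Filter Topology

/-- Partial sum of the depth-one series: the sum of `z ^ k / k ^ n` over `0 < k ≤ N`. -/
noncomputable def polylogPartialSum (n : ℕ) (z : ℂ) (N : ℕ) : ℂ :=
  ∑ k ∈ Finset.Icc 1 N, z ^ k / (k : ℂ) ^ n

/-- `Li_n(z)`, the (possibly only conditionally convergent) sum of its series. -/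
noncomputable def polylog (n : ℕ) (z : ℂ) : ℂ :=
  limUnder atTop (polylogPartialSum n z)

/-- Partial sum of the depth-two series: the sum of
`z₁ ^ k₁ * z₂ ^ k₂ / (k₁ ^ n₁ * k₂ ^ n₂)` over `0 < k₁ < k₂ ≤ N`. -/
noncomputable def doublePolylogPartialSum (n₁ n₂ : ℕ) (z₁ z₂ : ℂ) (N : ℕ) : ℂ :=
  ∑ k₂ ∈ Finset.Icc 1 N, ∑ k₁ ∈ Finset.Ico 1 k₂,
    (z₁ ^ k₁ * z₂ ^ k₂) / ((k₁ : ℂ) ^ n₁ * (k₂ : ℂ) ^ n₂)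

/-- `Li_{n₁,n₂}(z₁,z₂)`, the (possibly only conditionally convergent) sum of its series. -/
noncomputable def doublePolylog (n₁ n₂ : ℕ) (z₁ z₂ : ℂ) : ℂ :=
  limUnder atTop (doublePolylogPartialSum n₁ n₂ z₁ z₂)

/-- The values `Li_n(z)` at `z = 1` and `z = -1`, with the convention `Li_0(1) = Li_0(-1) = -1/2`
and with the number `c` standing for the divergent symbol `Li_1(1)`. -/
noncomputable def signPolylog (c : ℂ) (n : ℕ) (z : ℂ) : ℂ :=
  open Classical in
  if n = 0 then -(1 / 2) else if n = 1 ∧ z = 1 then c else polylog n z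

/-! The proof works with finite sums and passes to the limit only at the end. Put `a = n₁ - 1`, `b =
n₂ - 1`, and sum `z₁ ^ |x| * z₂ ^ |y| / (x ^ n₁ * y ^ n₂)` over nonzero integers `x + y = m` with `1
≤ m ≤ N` and `x, y ≤ N`. The region `x, y > 0` gives the product of the depth-one sums, up to a
corner `x + y > N`. The regions `x < 0` and `y < 0` give the two double sums, with signs `(-1) ^ n₁`
and `(-1) ^ n₂`.

Partial fractions (`pow_mul_pow_eq_partialFraction`) rewrite the same sum through terms `1 / (m ^ k
* x ^ i)`, where `m` and `x` are almost independent. The contributions of `x` and `-x` cancel for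
odd `i` and double for even `i`, up to corners and the diagonal `x = m` (`shiftedSum_eq`). This
leaves products of depth-one sums; the diagonals account for the `Li_0 = -1/2` terms.

For odd weight the two double sums enter with opposite signs (`sum_lattice_eq_sum_shiftedSum`),
whereas the stuffle product (`doublePolylogPartialSum_add_swap`) contains their sum. Combining the
two isolates one of them (`doublePolylogPartialSum_eq_parityFormula`). The corners are `O(log² N /
N)`, and the possibly divergent `Li_1(1)` has total coefficient zero already at finite level. -/

section FiniteSums

/-! ### Reindexing of finite sums over triangles and corners. -/

variable {M : Type*} [AddCommMonoid M]

lemma sum_triangle_eq_sum_sub (N : ℕ) (g : ℕ → ℕ → M) :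
    ∑ k ∈ Finset.Icc 1 N, ∑ p ∈ Finset.Ico 1 k, g p k =
      ∑ m ∈ Finset.Icc 1 N, ∑ p ∈ Finset.Icc 1 (N - m), g p (m + p) := by
  rw [Finset.sum_sigma', Finset.sum_sigma']
  refine Finset.sum_nbij' (fun q => ⟨q.1 - q.2, q.2⟩) (fun q => ⟨q.1 + q.2, q.2⟩) ?_ ?_ ?_ ?_ ?_
  · rintro ⟨k, p⟩ h
    simp only [Finset.mem_sigma, Finset.mem_Icc, Finset.mem_Ico] at h ⊢
    omega
  · rintro ⟨k, p⟩ h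
    simp only [Finset.mem_sigma, Finset.mem_Icc, Finset.mem_Ico] at h ⊢
    omega
  · rintro ⟨k, p⟩ h
    simp only [Finset.mem_sigma, Finset.mem_Icc, Finset.mem_Ico] at h
    simp only [Sigma.mk.injEq, heq_eq_eq, and_true]
    omega
  · rintro ⟨k, p⟩ h
    simp
  · rintro ⟨k, p⟩ h
    simp only [Finset.mem_sigma, Finset.mem_Icc, Finset.mem_Ico] at h
    simp only
    congr 1
    omega

lemma sum_triangle_eq_sum_add (N : ℕ) (g : ℕ → ℕ → M) :
    ∑ x ∈ Finset.Icc 1 N, ∑ y ∈ Finset.Icc 1 (N - x), g x y =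
      ∑ m ∈ Finset.Icc 1 N, ∑ x ∈ Finset.Ico 1 m, g x (m - x) := by
  rw [Finset.sum_sigma', Finset.sum_sigma']
  refine Finset.sum_nbij' (fun q => ⟨q.1 + q.2, q.1⟩) (fun q => ⟨q.2, q.1 - q.2⟩) ?_ ?_ ?_ ?_ ?_
  · rintro ⟨k, p⟩ h
    simp only [Finset.mem_sigma, Finset.mem_Icc, Finset.mem_Ico] at h ⊢
    omega
  · rintro ⟨k, p⟩ h
    simp only [Finset.mem_sigma, Finset.mem_Icc, Finset.mem_Ico] at h ⊢
    omega
  · rintro ⟨k, p⟩ h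
    simp
  · rintro ⟨k, p⟩ h
    simp only [Finset.mem_sigma, Finset.mem_Icc, Finset.mem_Ico] at h
    simp only [Sigma.mk.injEq, heq_eq_eq, and_true]
    omega
  · rintro ⟨k, p⟩ h
    simp

lemma sum_Icc_eq_sum_Icc_sub_add_sum_Ioc (N x : ℕ) (f : ℕ → M) :
    ∑ y ∈ Finset.Icc 1 N, f y =
      ∑ y ∈ Finset.Icc 1 (N - x), f y + ∑ y ∈ Finset.Ioc (N - x) N, f y := by
  rw [← Finset.sum_union]
  · congr 1
    ext y
    simp only [Finset.mem_union, Finset.mem_Icc, Finset.mem_Ioc]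
    omega
  · rw [Finset.disjoint_left]
    intro y
    simp only [Finset.mem_Icc, Finset.mem_Ioc]
    omega

lemma sum_Icc_eq_sum_Ico_add_sum_Ioc {N m : ℕ} (hm : m ∈ Finset.Icc 1 N) (f : ℕ → M) :
    ∑ y ∈ Finset.Icc 1 N, f y =
      ∑ y ∈ Finset.Ico 1 m, f y + f m + ∑ y ∈ Finset.Ioc m N, f y := by
  rw [Finset.mem_Icc] at hm
  rw [← Finset.sum_singleton f m, ← Finset.sum_union, ← Finset.sum_union]
  · congr 1
    ext y
    simp only [Finset.mem_union, Finset.mem_Icc, Finset.mem_Ioc, Finset.mem_Ico,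
      Finset.mem_singleton]
    omega
  · rw [Finset.disjoint_left]
    intro y
    simp only [Finset.mem_union, Finset.mem_Ioc, Finset.mem_Ico, Finset.mem_singleton]
    omega
  · rw [Finset.disjoint_left]
    intro y
    simp only [Finset.mem_Ico, Finset.mem_singleton]
    omega

lemma sum_Ioc_eq_sum_Icc_add (N m : ℕ) (f : ℕ → M) :
    ∑ x ∈ Finset.Ioc m N, f x = ∑ p ∈ Finset.Icc 1 (N - m), f (m + p) := by
  refine Finset.sum_nbij' (fun x => x - m) (fun p => m + p) ?_ ?_ ?_ ?_ ?_ <;> intro x hx <;>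
    simp only [Finset.mem_Icc, Finset.mem_Ioc] at hx ⊢
  · omega
  · omega
  · omega
  · omega
  · congr 1
    omega

lemma sum_Ico_one_reflect (m : ℕ) (f : ℕ → M) :
    ∑ x ∈ Finset.Ico 1 m, f (m - x) = ∑ x ∈ Finset.Ico 1 m, f x := by
  refine Finset.sum_nbij' (fun x => m - x) (fun x => m - x) ?_ ?_ ?_ ?_ ?_ <;> intro x hx <;>
    simp only [Finset.mem_Ico] at hx ⊢ <;> omega

lemma sum_Ioc_triangle_comm (N : ℕ) (g : ℕ → ℕ → M) :
    ∑ x ∈ Finset.Icc 1 N, ∑ y ∈ Finset.Ioc x N, g x y =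
      ∑ y ∈ Finset.Icc 1 N, ∑ x ∈ Finset.Ico 1 y, g x y := by
  refine Finset.sum_comm' fun x y => ?_
  simp only [Finset.mem_Icc, Finset.mem_Ioc, Finset.mem_Ico]
  omega

lemma sum_corner_comm (N : ℕ) (g : ℕ → ℕ → M) :
    ∑ x ∈ Finset.Icc 1 N, ∑ y ∈ Finset.Ioc (N - x) N, g x y =
      ∑ y ∈ Finset.Icc 1 N, ∑ x ∈ Finset.Ioc (N - y) N, g x y := by
  refine Finset.sum_comm' fun x y => ?_
  simp only [Finset.mem_Icc, Finset.mem_Ioc]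
  omega

end FiniteSums

/-! ### Partial fractions. -/

section PartialFractions

/-- One half of the partial fraction expansion of `u ^ (a + 1) * v ^ (b + 1)`. -/
def partialFractionHalf {R : Type*} [CommRing R] (t v : R) (a b : ℕ) : R :=
  ∑ j ∈ Finset.range (a + b + 1), (j.choose a : R) * (t ^ (j + 1) * v ^ (a + b + 1 - j))

variable {R : Type*} [CommRing R]

lemma partialFractionHalf_zero_succ (t v : R) (b : ℕ) :
    partialFractionHalf t v 0 (b + 1) = t * (partialFractionHalf t v 0 b + v ^ (b + 2)) := by
  unfold partialFractionHalf
  rw [show 0 + (b + 1) + 1 = (0 + b + 1) + 1 by ring, Finset.sum_range_succ', mul_add,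
    Finset.mul_sum]
  congr 1
  · refine Finset.sum_congr rfl fun j _ => ?_
    rw [show 0 + b + 1 + 1 - (j + 1) = 0 + b + 1 - j by omega]
    simp only [Nat.choose_zero_right, Nat.cast_one]
    ring
  · simp

lemma partialFractionHalf_succ_zero (t v : R) (a : ℕ) :
    partialFractionHalf t v (a + 1) 0 = t * partialFractionHalf t v a 0 := by
  have key : ∀ a : ℕ, partialFractionHalf t v a 0 = t ^ (a + 1) * v := by
    intro a
    unfold partialFractionHalf
    rw [Finset.sum_range_succ, Finset.sum_eq_zero]
    · simp
    · intro j hj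
      rw [Nat.choose_eq_zero_of_lt (by simpa using hj)]
      simp
  rw [key, key]
  ring

/-- Pascal's rule. The recursion is the one that `u ^ (a + 1) * v ^ (b + 1)` obeys when a factor `u
* v` is replaced by `t * (u + v)`. -/
lemma partialFractionHalf_succ_succ (t v : R) (a b : ℕ) :
    partialFractionHalf t v (a + 1) (b + 1) =
      t * (partialFractionHalf t v a (b + 1) + partialFractionHalf t v (a + 1) b) := by
  unfold partialFractionHalf
  rw [show a + 1 + (b + 1) + 1 = (a + (b + 1) + 1) + 1 by ring, Finset.sum_range_succ',
    show a + 1 + b + 1 = a + (b + 1) + 1 by ring, ← Finset.sum_add_distrib, Finset.mul_sum]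
  simp only [Nat.choose_zero_succ, Nat.cast_zero, zero_mul, add_zero]
  refine Finset.sum_congr rfl fun j _ => ?_
  rw [show a + (b + 1) + 1 + 1 - (j + 1) = a + (b + 1) + 1 - j by omega, Nat.choose_succ_succ]
  push_cast
  ring

/-- Partial fractions: with `u = 1 / x`, `v = 1 / y` and `t = 1 / (x + y)`. -/
lemma pow_mul_pow_eq_partialFraction {t u v : R} (h : u * v = t * (u + v)) (a b : ℕ) :
    u ^ (a + 1) * v ^ (b + 1) = partialFractionHalf t v a b + partialFractionHalf t u b a := by
  induction a generalizing b with
  | zero =>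
    induction b with
    | zero =>
      simp only [partialFractionHalf, zero_add, Finset.range_one, Finset.sum_singleton]
      simp
      linear_combination h
    | succ b ih =>
      rw [partialFractionHalf_zero_succ, partialFractionHalf_succ_zero]
      linear_combination v ^ (b + 1) * h + t * ih
  | succ a iha =>
    induction b with
    | zero =>
      rw [partialFractionHalf_zero_succ, partialFractionHalf_succ_zero]
      linear_combination u ^ (a + 1) * h + t * iha 0
    | succ b ih =>
      rw [partialFractionHalf_succ_succ, partialFractionHalf_succ_succ]
      linear_combination u ^ (a + 1) * v ^ (b + 1) * h + t * iha (b + 1) + t * ih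

lemma inv_mul_inv_of_add {x y m : ℂ} (hx : x ≠ 0) (hy : y ≠ 0) (hm : m ≠ 0) (h : x + y = m) :
    x⁻¹ * y⁻¹ = m⁻¹ * (x⁻¹ + y⁻¹) := by
  subst h
  field_simp
  ring

end PartialFractions

/-! ### Truncated stuffle product and the sums over shifted ranges. -/

section FiniteIdentities

/-- The sum of `z₁ ^ x * z₂ ^ y / (x ^ a * y ^ b)` over `1 ≤ x, y ≤ N` with `N < x + y`. -/
noncomputable def cornerSum (a b : ℕ) (z₁ z₂ : ℂ) (N : ℕ) : ℂ :=
  ∑ x ∈ Finset.Icc 1 N, ∑ y ∈ Finset.Ioc (N - x) N,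
    (z₁ ^ x / (x : ℂ) ^ a) * (z₂ ^ y / (y : ℂ) ^ b)

/-- The sum of `y ^ m * z ^ |x| / (m ^ k * x ^ i)` over `1 ≤ m ≤ N` and the integers
`x ∈ [m - N, N]` different from `0` and `m`. -/
noncomputable def shiftedSum (k i : ℕ) (y z : ℂ) (N : ℕ) : ℂ :=
  ∑ m ∈ Finset.Icc 1 N, y ^ m / (m : ℂ) ^ k *
    (∑ x ∈ Finset.Ico 1 m, z ^ x / (x : ℂ) ^ i +
      ∑ p ∈ Finset.Icc 1 (N - m), z ^ (m + p) / ((m + p : ℕ) : ℂ) ^ i +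
      ∑ p ∈ Finset.Icc 1 (N - m), z ^ p / (-(p : ℂ)) ^ i)

lemma polylogPartialSum_mul (a b : ℕ) (z₁ z₂ : ℂ) (N : ℕ) :
    polylogPartialSum a z₁ N * polylogPartialSum b z₂ N =
      ∑ x ∈ Finset.Icc 1 N, ∑ y ∈ Finset.Icc 1 N,
        (z₁ ^ x / (x : ℂ) ^ a) * (z₂ ^ y / (y : ℂ) ^ b) := by
  unfold polylogPartialSum
  rw [Finset.sum_mul_sum]

lemma polylogPartialSum_mul_sub_cornerSum (a b : ℕ) (z₁ z₂ : ℂ) (N : ℕ) :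
    polylogPartialSum a z₁ N * polylogPartialSum b z₂ N - cornerSum a b z₁ z₂ N =
      ∑ x ∈ Finset.Icc 1 N, ∑ y ∈ Finset.Icc 1 (N - x),
        (z₁ ^ x / (x : ℂ) ^ a) * (z₂ ^ y / (y : ℂ) ^ b) := by
  rw [polylogPartialSum_mul, cornerSum, ← Finset.sum_sub_distrib]
  refine Finset.sum_congr rfl fun x _ => ?_
  rw [sum_Icc_eq_sum_Icc_sub_add_sum_Ioc N x, add_sub_cancel_right]

lemma doublePolylogPartialSum_add_swap (a b : ℕ) (z₁ z₂ : ℂ) (N : ℕ) :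
    doublePolylogPartialSum a b z₁ z₂ N + doublePolylogPartialSum b a z₂ z₁ N =
      polylogPartialSum a z₁ N * polylogPartialSum b z₂ N -
        polylogPartialSum (a + b) (z₁ * z₂) N := by
  rw [polylogPartialSum_mul, Finset.sum_congr rfl fun x hx =>
    sum_Icc_eq_sum_Ico_add_sum_Ioc hx _, Finset.sum_add_distrib, Finset.sum_add_distrib,
    sum_Ioc_triangle_comm, polylogPartialSum, doublePolylogPartialSum, doublePolylogPartialSum]
  have h₁ : ∀ x : ℕ, z₁ ^ x / (x : ℂ) ^ a * (z₂ ^ x / (x : ℂ) ^ b) =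
      (z₁ * z₂) ^ x / (x : ℂ) ^ (a + b) := by
    intro x
    rw [div_mul_div_comm, mul_pow, pow_add]
  simp only [h₁, div_mul_div_comm]
  have h₂ : ∀ x y : ℕ, z₂ ^ y * z₁ ^ x / ((y : ℂ) ^ b * (x : ℂ) ^ a) =
      z₁ ^ x * z₂ ^ y / ((x : ℂ) ^ a * (y : ℂ) ^ b) := by
    intro x y
    rw [mul_comm, mul_comm ((y : ℂ) ^ b)]
  simp only [h₂]
  ring

/-- The positive `x` fill `[1, N]` except for `x = m`: the full product minus the diagonal. The
negative `x = -p` with `p ≤ N - m` give `(-1) ^ i` times the sum over the triangle `m + p ≤ N`,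
which is the product minus the corner. -/
lemma shiftedSum_eq (k i : ℕ) (y z : ℂ) (N : ℕ) :
    shiftedSum k i y z N =
      (1 + (-1) ^ i) * (polylogPartialSum i z N * polylogPartialSum k y N) -
        (-1) ^ i * cornerSum k i y z N - polylogPartialSum (k + i) (y * z) N := by
  have h := polylogPartialSum_mul_sub_cornerSum k i y z N
  have h' := polylogPartialSum_mul k i y z N
  have key : shiftedSum k i y z N =
      ∑ x ∈ Finset.Icc 1 N, ∑ p ∈ Finset.Icc 1 N,
        (y ^ x / (x : ℂ) ^ k) * (z ^ p / (p : ℂ) ^ i) +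
      (-1) ^ i * ∑ x ∈ Finset.Icc 1 N, ∑ p ∈ Finset.Icc 1 (N - x),
        (y ^ x / (x : ℂ) ^ k) * (z ^ p / (p : ℂ) ^ i) - polylogPartialSum (k + i) (y * z) N := by
    rw [shiftedSum, polylogPartialSum, Finset.mul_sum, ← Finset.sum_add_distrib,
      ← Finset.sum_sub_distrib]
    refine Finset.sum_congr rfl fun m hm => ?_
    rw [← Finset.mul_sum, ← Finset.mul_sum, sum_Icc_eq_sum_Ico_add_sum_Ioc hm,
      sum_Ioc_eq_sum_Icc_add N m fun x => z ^ x / (x : ℂ) ^ i]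
    have h₁ : ∑ p ∈ Finset.Icc 1 (N - m), z ^ p / (-(p : ℂ)) ^ i =
        (-1) ^ i * ∑ p ∈ Finset.Icc 1 (N - m), z ^ p / (p : ℂ) ^ i := by
      rw [Finset.mul_sum]
      refine Finset.sum_congr rfl fun p _ => ?_
      rw [neg_pow, div_mul_eq_div_div, div_eq_mul_inv (z ^ p) ((-1) ^ i), ← inv_pow, inv_neg_one]
      ring
    have h₂ : (y * z) ^ m / (m : ℂ) ^ (k + i) =
        y ^ m / (m : ℂ) ^ k * (z ^ m / (m : ℂ) ^ i) := by
      rw [div_mul_div_comm, mul_pow, pow_add]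
    rw [h₁, h₂]
    ring
  rw [key, ← h, ← h']
  ring

end FiniteIdentities

/-! ### The lattice sum evaluated in two ways. -/

section ParityIdentity

lemma sum_mul_partialFractionHalf {ι : Type*} (s : Finset ι) (ε ζ X : ι → ℂ) (m η : ℂ) (a b : ℕ)
    (h : ∀ p ∈ s, ε p = η * ζ p) :
    ∑ p ∈ s, ε p * partialFractionHalf m⁻¹ (X p)⁻¹ a b =
      ∑ j ∈ Finset.range (a + b + 1), (j.choose a : ℂ) *
        (η / m ^ (j + 1) * ∑ p ∈ s, ζ p / X p ^ (a + b + 1 - j)) := by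
  simp only [partialFractionHalf, Finset.mul_sum]
  rw [Finset.sum_comm]
  refine Finset.sum_congr rfl fun j _ => Finset.sum_congr rfl fun p hp => ?_
  rw [h p hp, inv_pow, inv_pow, div_eq_mul_inv, div_eq_mul_inv]
  ring

/-- Since `z₂ ^ 2 = 1`, powers of `z₂` depend only on parity, so in all three ranges of `x` the sign
factor is `z₂ ^ m * (z₁ * z₂) ^ |x|`, separating `m` from `x`. -/
lemma sum_partialFractionHalf_eq_sum_shiftedSum (a b : ℕ) {z₁ z₂ : ℂ} (hz₂ : z₂ ^ 2 = 1) (N : ℕ) :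
    ∑ m ∈ Finset.Icc 1 N,
      (∑ x ∈ Finset.Ico 1 m, z₁ ^ x * z₂ ^ (m - x) *
          partialFractionHalf (m : ℂ)⁻¹ (x : ℂ)⁻¹ a b +
        ∑ p ∈ Finset.Icc 1 (N - m), z₁ ^ (m + p) * z₂ ^ p *
          partialFractionHalf (m : ℂ)⁻¹ ((m + p : ℕ) : ℂ)⁻¹ a b +
        ∑ p ∈ Finset.Icc 1 (N - m), z₁ ^ p * z₂ ^ (m + p) *
          partialFractionHalf (m : ℂ)⁻¹ (-(p : ℂ))⁻¹ a b) =
      ∑ j ∈ Finset.range (a + b + 1), (j.choose a : ℂ) *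
        shiftedSum (j + 1) (a + b + 1 - j) z₂ (z₁ * z₂) N := by
  have hsq : ∀ n : ℕ, z₂ ^ n * z₂ ^ n = 1 := fun n => by
    rw [← mul_pow, ← sq, hz₂, one_pow]
  simp only [shiftedSum, Finset.mul_sum (Finset.Icc 1 N)]
  rw [Finset.sum_comm]
  refine Finset.sum_congr rfl fun m _ => ?_
  rw [sum_mul_partialFractionHalf _ _ (fun x : ℕ => (z₁ * z₂) ^ x) (fun x : ℕ => (x : ℂ)) m
      (z₂ ^ m), sum_mul_partialFractionHalf _ _ (fun p : ℕ => (z₁ * z₂) ^ (m + p))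
      (fun p : ℕ => ((m + p : ℕ) : ℂ)) m (z₂ ^ m),
    sum_mul_partialFractionHalf _ _ (fun p : ℕ => (z₁ * z₂) ^ p) (fun p : ℕ => -(p : ℂ)) m
      (z₂ ^ m), ← Finset.sum_add_distrib, ← Finset.sum_add_distrib]
  · refine Finset.sum_congr rfl fun j _ => ?_
    ring
  · intro p _
    rw [mul_pow, pow_add]
    ring
  · intro p _
    rw [mul_pow, pow_add z₂]
    linear_combination (-(z₁ ^ (m + p) * z₂ ^ p)) * hsq m
  · intro x hx
    obtain ⟨y, rfl⟩ := Nat.exists_eq_add_of_le (Finset.mem_Ico.mp hx).2.le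
    rw [Nat.add_sub_cancel_left, mul_pow, pow_add]
    linear_combination (-(z₁ ^ x * z₂ ^ y)) * hsq x

lemma sum_lattice_eq_sum_shiftedSum (a b : ℕ) {z₁ z₂ : ℂ} (hz₁ : z₁ ^ 2 = 1) (hz₂ : z₂ ^ 2 = 1)
    (N : ℕ) :
    polylogPartialSum (a + 1) z₁ N * polylogPartialSum (b + 1) z₂ N -
        cornerSum (a + 1) (b + 1) z₁ z₂ N +
        (-1) ^ (a + 1) * doublePolylogPartialSum (a + 1) (b + 1) z₁ z₂ N +
        (-1) ^ (b + 1) * doublePolylogPartialSum (b + 1) (a + 1) z₂ z₁ N =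
      ∑ j ∈ Finset.range (a + b + 1),
        ((j.choose a : ℂ) * shiftedSum (j + 1) (a + b + 1 - j) z₁ (z₁ * z₂) N +
          (j.choose b : ℂ) * shiftedSum (j + 1) (a + b + 1 - j) z₂ (z₁ * z₂) N) := by
  have h₁ := sum_partialFractionHalf_eq_sum_shiftedSum a b (z₁ := z₂) hz₁ N
  have h₂ := sum_partialFractionHalf_eq_sum_shiftedSum b a (z₁ := z₁) hz₂ N
  rw [mul_comm z₂ z₁] at h₁
  rw [add_comm b a] at h₂
  rw [Finset.sum_add_distrib, ← h₁, ← h₂, polylogPartialSum_mul_sub_cornerSum,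
    sum_triangle_eq_sum_add, doublePolylogPartialSum, doublePolylogPartialSum,
    sum_triangle_eq_sum_sub N fun k₁ k₂ => (z₁ ^ k₁ * z₂ ^ k₂) /
      ((k₁ : ℂ) ^ (a + 1) * (k₂ : ℂ) ^ (b + 1)),
    sum_triangle_eq_sum_sub N fun k₁ k₂ => (z₂ ^ k₁ * z₁ ^ k₂) /
      ((k₁ : ℂ) ^ (b + 1) * (k₂ : ℂ) ^ (a + 1))]
  simp only [Finset.mul_sum, ← Finset.sum_add_distrib (s := Finset.Icc 1 N)]
  refine Finset.sum_congr rfl fun m hm => ?_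
  have hm0 : (m : ℂ) ≠ 0 := by
    have := (Finset.mem_Icc.mp hm).1
    exact_mod_cast (by omega : m ≠ 0)
  -- `hA`, `hB` and `hC` treat the decompositions `m = x + (m - x)`, `m = -p + (m + p)` and `m = (m
  -- + p) + (-p)`. In `hA` one half is reflected so that its inner variable is again called `x`.
  have hA : ∑ x ∈ Finset.Ico 1 m, z₁ ^ x / (x : ℂ) ^ (a + 1) *
        (z₂ ^ (m - x) / ((m - x : ℕ) : ℂ) ^ (b + 1)) =
      ∑ x ∈ Finset.Ico 1 m, z₂ ^ x * z₁ ^ (m - x) *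
          partialFractionHalf (m : ℂ)⁻¹ (x : ℂ)⁻¹ a b +
        ∑ x ∈ Finset.Ico 1 m, z₁ ^ x * z₂ ^ (m - x) *
          partialFractionHalf (m : ℂ)⁻¹ (x : ℂ)⁻¹ b a := by
    rw [← sum_Ico_one_reflect m fun x => z₂ ^ x * z₁ ^ (m - x) *
      partialFractionHalf (m : ℂ)⁻¹ (x : ℂ)⁻¹ a b, ← Finset.sum_add_distrib]
    refine Finset.sum_congr rfl fun x hx => ?_
    rw [Finset.mem_Ico] at hx
    have hx0 : (x : ℂ) ≠ 0 := by exact_mod_cast (by omega : x ≠ 0)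
    have hy0 : ((m - x : ℕ) : ℂ) ≠ 0 := by exact_mod_cast (by omega : m - x ≠ 0)
    have hxy : (x : ℂ) + ((m - x : ℕ) : ℂ) = m := by exact_mod_cast (by omega : x + (m - x) = m)
    have := pow_mul_pow_eq_partialFraction (inv_mul_inv_of_add hx0 hy0 hm0 hxy) a b
    rw [Nat.sub_sub_self hx.2.le, ← mul_comm (z₁ ^ x), ← mul_add, ← this, inv_pow, inv_pow]
    ring
  have hB : ∑ p ∈ Finset.Icc 1 (N - m), (-1) ^ (a + 1) * (z₁ ^ p * z₂ ^ (m + p) /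
        ((p : ℂ) ^ (a + 1) * ((m + p : ℕ) : ℂ) ^ (b + 1))) =
      ∑ p ∈ Finset.Icc 1 (N - m), z₂ ^ (m + p) * z₁ ^ p *
          partialFractionHalf (m : ℂ)⁻¹ ((m + p : ℕ) : ℂ)⁻¹ a b +
        ∑ p ∈ Finset.Icc 1 (N - m), z₁ ^ p * z₂ ^ (m + p) *
          partialFractionHalf (m : ℂ)⁻¹ (-(p : ℂ))⁻¹ b a := by
    rw [← Finset.sum_add_distrib]
    refine Finset.sum_congr rfl fun p hp => ?_
    rw [Finset.mem_Icc] at hp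
    have hx0 : -(p : ℂ) ≠ 0 := neg_ne_zero.mpr (by exact_mod_cast (by omega : p ≠ 0))
    have hy0 : ((m + p : ℕ) : ℂ) ≠ 0 := by exact_mod_cast (by omega : m + p ≠ 0)
    have hxy : -(p : ℂ) + ((m + p : ℕ) : ℂ) = m := by push_cast; ring
    have := pow_mul_pow_eq_partialFraction (inv_mul_inv_of_add hx0 hy0 hm0 hxy) a b
    rw [← mul_comm (z₁ ^ p), ← mul_add, ← this, inv_neg, neg_pow (p : ℂ)⁻¹, inv_pow, inv_pow]
    ring
  have hC : ∑ p ∈ Finset.Icc 1 (N - m), (-1) ^ (b + 1) * (z₂ ^ p * z₁ ^ (m + p) /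
        ((p : ℂ) ^ (b + 1) * ((m + p : ℕ) : ℂ) ^ (a + 1))) =
      ∑ p ∈ Finset.Icc 1 (N - m), z₂ ^ p * z₁ ^ (m + p) *
          partialFractionHalf (m : ℂ)⁻¹ (-(p : ℂ))⁻¹ a b +
        ∑ p ∈ Finset.Icc 1 (N - m), z₁ ^ (m + p) * z₂ ^ p *
          partialFractionHalf (m : ℂ)⁻¹ ((m + p : ℕ) : ℂ)⁻¹ b a := by
    rw [← Finset.sum_add_distrib]
    refine Finset.sum_congr rfl fun p hp => ?_
    rw [Finset.mem_Icc] at hp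
    have hx0 : -(p : ℂ) ≠ 0 := neg_ne_zero.mpr (by exact_mod_cast (by omega : p ≠ 0))
    have hy0 : ((m + p : ℕ) : ℂ) ≠ 0 := by exact_mod_cast (by omega : m + p ≠ 0)
    have hxy : ((m + p : ℕ) : ℂ) + -(p : ℂ) = m := by push_cast; ring
    have := pow_mul_pow_eq_partialFraction (inv_mul_inv_of_add hy0 hx0 hm0 hxy) a b
    rw [← mul_comm (z₂ ^ p), ← mul_add, ← this, inv_neg, neg_pow (p : ℂ)⁻¹, inv_pow, inv_pow]
    ring
  rw [hA, hB, hC]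
  ring

end ParityIdentity

/-! ### Vanishing of the corners and convergence in depth one. -/

section Limits

/-- On the corner `1 ≤ (x + y) / N`, so `1 / (x² y) ≤ (1 / x² + 1 / (x y)) / N`. There are `x`
values of `y` for each `x`, so the two terms sum to at most `H / N` and `H² / N`, with `H` the
harmonic number. -/
lemma norm_cornerSum_le {a b : ℕ} (ha : 2 ≤ a) (hb : 1 ≤ b) {z₁ z₂ : ℂ} (hz₁ : ‖z₁‖ = 1)
    (hz₂ : ‖z₂‖ = 1) (N : ℕ) :
    ‖cornerSum a b z₁ z₂ N‖ ≤ ((1 + Real.log N) + (1 + Real.log N) ^ 2) / N := by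
  set H : ℝ := ∑ x ∈ Finset.Icc 1 N, (x : ℝ)⁻¹ with hH
  have hH0 : 0 ≤ H := Finset.sum_nonneg fun x _ => by positivity
  have hHle : H ≤ 1 + Real.log N := by
    have := harmonic_le_one_add_log N
    rw [harmonic_eq_sum_Icc] at this
    push_cast at this
    exact this
  have hterm : ∀ x ∈ Finset.Icc 1 N, ∀ y ∈ Finset.Ioc (N - x) N,
      ‖(z₁ ^ x / (x : ℂ) ^ a) * (z₂ ^ y / (y : ℂ) ^ b)‖ ≤
        (((x : ℝ)⁻¹) ^ 2 + (x : ℝ)⁻¹ * (y : ℝ)⁻¹) / N := by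
    intro x hx y hy
    rw [Finset.mem_Icc] at hx
    rw [Finset.mem_Ioc] at hy
    have hx1 : (1 : ℝ) ≤ x := by exact_mod_cast hx.1
    have hy1 : (1 : ℝ) ≤ y := by exact_mod_cast (by omega : 1 ≤ y)
    have hN : (0 : ℝ) < N := by exact_mod_cast (by omega : 0 < N)
    have hxy : (N : ℝ) ≤ x + y := by exact_mod_cast (by omega : N ≤ x + y)
    rw [norm_mul, norm_div, norm_div, norm_pow, norm_pow, norm_pow, norm_pow, hz₁, hz₂, one_pow,
      one_pow, Complex.norm_natCast, Complex.norm_natCast]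
    calc 1 / (x : ℝ) ^ a * (1 / (y : ℝ) ^ b) ≤ 1 / (x : ℝ) ^ 2 * (1 / (y : ℝ) ^ 1) := by
          gcongr
      _ ≤ _ := by
          rw [le_div_iff₀ hN]
          calc 1 / (x : ℝ) ^ 2 * (1 / (y : ℝ) ^ 1) * N
              ≤ 1 / (x : ℝ) ^ 2 * (1 / (y : ℝ) ^ 1) * (x + y) := by gcongr
            _ = _ := by
              field_simp
              ring
  calc ‖cornerSum a b z₁ z₂ N‖
      ≤ ∑ x ∈ Finset.Icc 1 N, ∑ y ∈ Finset.Ioc (N - x) N,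
          (((x : ℝ)⁻¹) ^ 2 + (x : ℝ)⁻¹ * (y : ℝ)⁻¹) / N :=
        norm_sum_le_of_le _ fun x hx => norm_sum_le_of_le _ fun y hy => hterm x hx y hy
    _ ≤ ∑ x ∈ Finset.Icc 1 N, ((x : ℝ)⁻¹ + (x : ℝ)⁻¹ * H) / N := by
        refine Finset.sum_le_sum fun x hx => ?_
        rw [← Finset.sum_div, Finset.sum_add_distrib, ← Finset.mul_sum, Finset.sum_const,
          Nat.card_Ioc, nsmul_eq_mul]
        rw [Finset.mem_Icc] at hx
        have hx0 : (x : ℝ) ≠ 0 := by exact_mod_cast (by omega : x ≠ 0)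
        rw [Nat.sub_sub_self hx.2, sq, mul_inv_cancel_left₀ hx0]
        gcongr
        refine Finset.sum_le_sum_of_subset_of_nonneg ?_ fun _ _ _ => by positivity
        intro y
        rw [Finset.mem_Icc, Finset.mem_Ioc]
        omega
    _ = (H + H ^ 2) / N := by
        rw [← Finset.sum_div, Finset.sum_add_distrib, ← Finset.sum_mul, ← hH, sq]
    _ ≤ _ := by gcongr

lemma tendsto_cornerSum_of_two_le {a b : ℕ} (ha : 2 ≤ a) (hb : 1 ≤ b) {z₁ z₂ : ℂ}
    (hz₁ : ‖z₁‖ = 1) (hz₂ : ‖z₂‖ = 1) : Tendsto (cornerSum a b z₁ z₂) atTop (𝓝 0) := by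
  refine squeeze_zero_norm (norm_cornerSum_le ha hb hz₁ hz₂) ?_
  have h : ∀ n : ℕ, Tendsto (fun N : ℕ => Real.log N ^ n / N) atTop (𝓝 0) := fun n => by
    simpa [Function.comp_def] using (Real.tendsto_pow_log_div_mul_add_atTop 1 0 n one_ne_zero).comp
      tendsto_natCast_atTop_atTop
  have := (((h 0).const_mul 2).add ((h 1).const_mul 3)).add (h 2)
  simp only [mul_zero, add_zero] at this
  refine this.congr fun N => ?_
  ring

lemma cornerSum_comm (a b : ℕ) (z₁ z₂ : ℂ) (N : ℕ) :
    cornerSum a b z₁ z₂ N = cornerSum b a z₂ z₁ N := by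
  rw [cornerSum, sum_corner_comm, cornerSum]
  simp only [mul_comm]

lemma tendsto_cornerSum {a b : ℕ} (ha : 1 ≤ a) (hb : 1 ≤ b) (hab : 3 ≤ a + b) {z₁ z₂ : ℂ}
    (hz₁ : ‖z₁‖ = 1) (hz₂ : ‖z₂‖ = 1) : Tendsto (cornerSum a b z₁ z₂) atTop (𝓝 0) := by
  rcases (by omega : 2 ≤ a ∨ 2 ≤ b) with h | h
  · exact tendsto_cornerSum_of_two_le h hb hz₁ hz₂
  · rw [funext (cornerSum_comm a b z₁ z₂)]
    exact tendsto_cornerSum_of_two_le h ha hz₂ hz₁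

lemma exists_tendsto_polylogPartialSum {n : ℕ} {z : ℂ} (hn : 1 ≤ n) (hz : z = 1 ∨ z = -1)
    (hnz : ¬ (n = 1 ∧ z = 1)) : ∃ l, Tendsto (polylogPartialSum n z) atTop (𝓝 l) := by
  have hshift : ∀ N, polylogPartialSum n z N =
      ∑ k ∈ Finset.range N, z ^ (k + 1) / ((k + 1 : ℕ) : ℂ) ^ n := by
    intro N
    rw [polylogPartialSum, Finset.range_eq_Ico,
      Finset.sum_Ico_add' (fun k : ℕ => z ^ k / (k : ℂ) ^ n) 0 N 1]
    rfl
  rw [funext hshift]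
  rcases hz with rfl | rfl
  · have hs : Summable fun k : ℕ => (1 : ℂ) ^ (k + 1) / ((k + 1 : ℕ) : ℂ) ^ n := by
      have := (summable_nat_add_iff 1).mpr
        (Complex.summable_one_div_nat_cpow (p := n).mpr (by
          simp only [Complex.natCast_re, Nat.one_lt_cast]; simp at hnz; omega))
      simpa using this
    exact ⟨_, hs.hasSum.tendsto_sum_nat⟩
  · obtain ⟨l, hl⟩ := Antitone.tendsto_alternating_series_of_tendsto_zero
      (f := fun k : ℕ => 1 / ((k : ℝ) + 1) ^ n)
      (fun i j hij => by
        have : (i : ℝ) ≤ j := by exact_mod_cast hij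
        dsimp only
        gcongr)
      (by
        have := (tendsto_one_div_add_atTop_nhds_zero_nat (𝕜 := ℝ)).pow n
        simpa [zero_pow (by omega : n ≠ 0)] using this)
    refine ⟨-(l : ℂ), ?_⟩
    have hl' := ((Complex.continuous_ofReal.tendsto l).comp hl).neg
    refine hl'.congr fun N => ?_
    simp only [Function.comp_apply, Complex.ofReal_sum, ← Finset.sum_neg_distrib]
    refine Finset.sum_congr rfl fun k _ => ?_
    push_cast
    ring

lemma tendsto_polylogPartialSum {n : ℕ} {z : ℂ} (hn : 1 ≤ n) (hz : z = 1 ∨ z = -1)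
    (hnz : ¬ (n = 1 ∧ z = 1)) : Tendsto (polylogPartialSum n z) atTop (𝓝 (polylog n z)) :=
  tendsto_nhds_limUnder (exists_tendsto_polylogPartialSum hn hz hnz)

end Limits

/-! ### The truncated parity formula and its limit. -/

section ParityFormula

/-- The right-hand side of the parity theorem, as an expression in the values `L n z`. -/
noncomputable def parityFormula (L : ℕ → ℂ → ℂ) (n₁ n₂ : ℕ) (z₁ z₂ : ℂ) : ℂ :=
  (-1 : ℂ) ^ n₁ *
      (∑ p ∈ (Finset.HasAntidiagonal.antidiagonal (n₁ + n₂)).filter (fun p => Even p.1),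
        L p.1 (z₁ * z₂) *
          (((p.2 - 1).choose (n₁ - 1) : ℂ) * L p.2 z₁ +
            ((p.2 - 1).choose (n₂ - 1) : ℂ) * L p.2 z₂)) -
    (1 / 2 : ℂ) * L (n₁ + n₂) (z₁ * z₂) +
    L n₁ z₁ * L n₂ z₂ * (if Even n₂ then 1 else 0)

/-- The total coefficient of `L 1 1` in the parity formula vanishes. -/
lemma parityFormula_congr {L L' : ℕ → ℂ → ℂ} (hL : ∀ n z, ¬ (n = 1 ∧ z = 1) → L n z = L' n z)
    {n₁ n₂ : ℕ} (hn₁ : 1 ≤ n₁) (hn₂ : 1 ≤ n₂) (hodd : Odd (n₁ + n₂)) {z₁ z₂ : ℂ}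
    (hconv : ¬ (n₂ = 1 ∧ z₂ = 1)) :
    parityFormula L n₁ n₂ z₁ z₂ = parityFormula L' n₁ n₂ z₁ z₂ := by
  have hw : L (n₁ + n₂) (z₁ * z₂) = L' (n₁ + n₂) (z₁ * z₂) := by
    refine hL _ _ fun h => ?_
    omega
  have heven : ∀ p : ℕ × ℕ, Even p.1 → L p.1 (z₁ * z₂) = L' p.1 (z₁ * z₂) := by
    refine fun p hp => hL _ _ fun h => ?_
    rw [h.1] at hp
    exact absurd hp (by decide)
  have hsecond : ∀ k, ((k - 1).choose (n₂ - 1) : ℂ) * L k z₂ =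
      ((k - 1).choose (n₂ - 1) : ℂ) * L' k z₂ := by
    intro k
    by_cases h : k = 1 ∧ z₂ = 1
    · have : 0 < n₂ - 1 := by
        have : n₂ ≠ 1 := fun h' => hconv ⟨h', h.2⟩
        omega
      rw [h.1, Nat.choose_eq_zero_of_lt (by simpa using this)]
      simp
    · rw [hL _ _ h]
  by_cases h₁ : n₁ = 1 ∧ z₁ = 1
  -- Here `n₂` is even and `z₁ * z₂ = z₂`: the summand `k = 1` contributes `-L n₂ z₂ * L 1 1`, which
  -- cancels the product term. In the other case, the binomial coefficient at `k = 1` vanishes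
  -- wherever `L 1 1` would occur.
  · obtain ⟨rfl, rfl⟩ := h₁
    have hn₂even : Even n₂ := by
      rcases hodd with ⟨r, hr⟩
      exact ⟨r, by omega⟩
    have hL₂ : L n₂ z₂ = L' n₂ z₂ := hL _ _ hconv
    have hmem : ((n₂, 1) : ℕ × ℕ) ∈
        (Finset.HasAntidiagonal.antidiagonal (1 + n₂)).filter (fun p => Even p.1) := by
      rw [Finset.mem_filter, Finset.HasAntidiagonal.mem_antidiagonal]
      exact ⟨add_comm _ _, hn₂even⟩
    unfold parityFormula
    rw [← Finset.add_sum_erase _ _ hmem, ← Finset.add_sum_erase _ _ hmem]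
    have hrest : ∀ p ∈ ((Finset.HasAntidiagonal.antidiagonal (1 + n₂)).filter
        (fun p => Even p.1)).erase (n₂, 1),
        L p.1 (1 * z₂) * (((p.2 - 1).choose (1 - 1) : ℂ) * L p.2 1 +
            ((p.2 - 1).choose (n₂ - 1) : ℂ) * L p.2 z₂) =
          L' p.1 (1 * z₂) * (((p.2 - 1).choose (1 - 1) : ℂ) * L' p.2 1 +
            ((p.2 - 1).choose (n₂ - 1) : ℂ) * L' p.2 z₂) := by
      intro p hp
      rw [Finset.mem_erase, Finset.mem_filter, Finset.HasAntidiagonal.mem_antidiagonal] at hp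
      have hp2 : p.2 ≠ 1 := by
        intro h
        refine hp.1 (Prod.ext ?_ h)
        have := hp.2.1
        simp only
        omega
      rw [heven p hp.2.2, hsecond, hL p.2 1 fun h => hp2 h.1]
    rw [Finset.sum_congr rfl hrest, hw, if_pos hn₂even]
    have hone := hsecond 1
    simp only [one_mul, hL₂, Nat.sub_self, Nat.choose_self, Nat.cast_one, pow_one] at hone ⊢
    linear_combination (-L' n₂ z₂) * hone
  · have hfirst : ∀ k, ((k - 1).choose (n₁ - 1) : ℂ) * L k z₁ =
        ((k - 1).choose (n₁ - 1) : ℂ) * L' k z₁ := by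
      intro k
      by_cases h : k = 1 ∧ z₁ = 1
      · have : 0 < n₁ - 1 := by
          have : n₁ ≠ 1 := fun h' => h₁ ⟨h', h.2⟩
          omega
        rw [h.1, Nat.choose_eq_zero_of_lt (by simpa using this)]
        simp
      · rw [hL _ _ h]
    unfold parityFormula
    rw [hw, hL _ _ h₁, hL _ _ hconv]
    congr 3
    refine Finset.sum_congr rfl fun p hp => ?_
    rw [heven p (Finset.mem_filter.mp hp).2, hfirst, hsecond]

lemma tendsto_parityFormula {L : ℕ → ℕ → ℂ → ℂ} {l : ℕ → ℂ → ℂ} {n₁ n₂ : ℕ} {z₁ z₂ : ℂ}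
    (h : ∀ n z, z = z₁ ∨ z = z₂ ∨ z = z₁ * z₂ → Tendsto (fun N => L N n z) atTop (𝓝 (l n z))) :
    Tendsto (fun N => parityFormula (L N) n₁ n₂ z₁ z₂) atTop (𝓝 (parityFormula l n₁ n₂ z₁ z₂)) := by
  have h₁ := fun n => h n z₁ (Or.inl rfl)
  have h₂ := fun n => h n z₂ (Or.inr (Or.inl rfl))
  have h₃ := fun n => h n (z₁ * z₂) (Or.inr (Or.inr rfl))
  unfold parityFormula
  exact (((tendsto_finsetSum _ fun p _ => (h₃ _).mul (((h₁ _).const_mul _).add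
    ((h₂ _).const_mul _))).const_mul _).sub ((h₃ _).const_mul _)).add
    (((h₁ _).mul (h₂ _)).mul_const _)

lemma sum_range_choose_right (a n : ℕ) : ∑ j ∈ Finset.range n, j.choose a = n.choose (a + 1) := by
  induction n with
  | zero => simp
  | succ n ih => rw [Finset.sum_range_succ, ih, Nat.choose_succ_succ, add_comm]

/-- The truncation at `N` of the values `Li_n(z)`, with `Li_0(z) = -1/2`. -/
noncomputable def truncatedPolylog (N n : ℕ) (z : ℂ) : ℂ :=
  if n = 0 then -(1 / 2) else polylogPartialSum n z N

/-- The sum of corner sums by which the truncated parity formula fails. -/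
noncomputable def cornerError (a b : ℕ) (z₁ z₂ : ℂ) (N : ℕ) : ℂ :=
  ∑ j ∈ Finset.range (a + b + 1), (-1) ^ (a + b + 1 - j) *
    ((j.choose a : ℂ) * cornerSum (j + 1) (a + b + 1 - j) z₁ (z₁ * z₂) N +
      (j.choose b : ℂ) * cornerSum (j + 1) (a + b + 1 - j) z₂ (z₁ * z₂) N)

/-- The diagonal terms carry `z₁ * (z₁ * z₂) = z₂` or `z₂ * (z₁ * z₂) = z₁`. By the hockey-stick
identity their coefficients add up to the binomials of the `s = 0` summand, and `2 * (-1/2) = -1`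
gives the sign. -/
lemma sum_shiftedSum_eq (a b : ℕ) (hodd : Odd (a + b)) {z₁ z₂ : ℂ} (hz₁ : z₁ ^ 2 = 1)
    (hz₂ : z₂ ^ 2 = 1) (N : ℕ) :
    ∑ j ∈ Finset.range (a + b + 1),
        ((j.choose a : ℂ) * shiftedSum (j + 1) (a + b + 1 - j) z₁ (z₁ * z₂) N +
          (j.choose b : ℂ) * shiftedSum (j + 1) (a + b + 1 - j) z₂ (z₁ * z₂) N) =
      2 * (∑ p ∈ (Finset.HasAntidiagonal.antidiagonal (a + 1 + (b + 1))).filter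
            (fun p => Even p.1),
        truncatedPolylog N p.1 (z₁ * z₂) *
          (((p.2 - 1).choose a : ℂ) * truncatedPolylog N p.2 z₁ +
            ((p.2 - 1).choose b : ℂ) * truncatedPolylog N p.2 z₂)) -
        cornerError a b z₁ z₂ N := by
  have hodd' : ¬ Even (a + b + 1 + 1) := by
    rw [Nat.not_even_iff_odd]
    simpa [add_assoc] using hodd.add_even even_two
  have hz₁₂ : z₁ * (z₁ * z₂) = z₂ := by linear_combination z₂ * hz₁
  have hz₂₁ : z₂ * (z₁ * z₂) = z₁ := by linear_combination z₁ * hz₂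
  have hca : (∑ j ∈ Finset.range (a + b + 1), (j.choose a : ℂ)) = ((a + b + 1).choose b : ℂ) := by
    rw [← Nat.cast_sum, sum_range_choose_right,
      Nat.choose_symm_of_eq_add (by ring : a + b + 1 = a + 1 + b)]
  have hcb : (∑ j ∈ Finset.range (a + b + 1), (j.choose b : ℂ)) = ((a + b + 1).choose a : ℂ) := by
    rw [← Nat.cast_sum, sum_range_choose_right,
      Nat.choose_symm_of_eq_add (by ring : a + b + 1 = b + 1 + a)]
  -- Split off `k = w`, the `Li_0` summand, and `k = 0`, absent because `w` is odd; the rest is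
  -- indexed by `k = j + 1`.
  rw [Finset.sum_filter, show a + 1 + (b + 1) = a + b + 1 + 1 by ring,
    ← Finset.Nat.sum_antidiagonal_swap, Finset.Nat.sum_antidiagonal_eq_sum_range_succ_mk,
    Finset.sum_range_succ _ (a + b + 1 + 1), Finset.sum_range_succ' _ (a + b + 1)]
  simp only [Prod.swap_prod_mk, Nat.sub_zero, if_neg hodd', add_zero, Nat.sub_self, Even.zero,
    if_true, Nat.add_sub_cancel, Nat.add_sub_add_right]
  have ht : ∀ n, n ≠ 0 → ∀ z, truncatedPolylog N n z = polylogPartialSum n z N :=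
    fun n hn z => if_neg hn
  have hterm : ∀ j ∈ Finset.range (a + b + 1),
      ((j.choose a : ℂ) * shiftedSum (j + 1) (a + b + 1 - j) z₁ (z₁ * z₂) N +
          (j.choose b : ℂ) * shiftedSum (j + 1) (a + b + 1 - j) z₂ (z₁ * z₂) N) =
        2 * (if Even (a + b + 1 - j) then
          truncatedPolylog N (a + b + 1 - j) (z₁ * z₂) *
            ((j.choose a : ℂ) * truncatedPolylog N (j + 1) z₁ +
              (j.choose b : ℂ) * truncatedPolylog N (j + 1) z₂) else 0) -
        (-1) ^ (a + b + 1 - j) *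
          ((j.choose a : ℂ) * cornerSum (j + 1) (a + b + 1 - j) z₁ (z₁ * z₂) N +
            (j.choose b : ℂ) * cornerSum (j + 1) (a + b + 1 - j) z₂ (z₁ * z₂) N) -
        (j.choose a : ℂ) * polylogPartialSum (a + b + 1 + 1) z₂ N -
        (j.choose b : ℂ) * polylogPartialSum (a + b + 1 + 1) z₁ N := by
    intro j hj
    rw [Finset.mem_range] at hj
    rw [shiftedSum_eq, shiftedSum_eq, hz₁₂, hz₂₁,
      show j + 1 + (a + b + 1 - j) = a + b + 1 + 1 by omega, ht (a + b + 1 - j) (by omega),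
      ht (j + 1) (by omega), ht (j + 1) (by omega)]
    split_ifs with he
    · rw [he.neg_one_pow]
      ring
    · rw [(Nat.not_even_iff_odd.mp he).neg_one_pow]
      ring
  rw [Finset.sum_congr rfl hterm, Finset.sum_sub_distrib, Finset.sum_sub_distrib,
    Finset.sum_sub_distrib, ← Finset.mul_sum, ← Finset.sum_mul, ← Finset.sum_mul, hca, hcb,
    ← cornerError]
  have h0 : ∀ z, truncatedPolylog N 0 z = -(1 / 2) := fun z => if_pos rfl
  rw [h0, ht _ (by omega), ht _ (by omega)]
  ring

lemma doublePolylogPartialSum_eq_parityFormula (a b : ℕ) (hodd : Odd (a + b)) {z₁ z₂ : ℂ}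
    (hz₁ : z₁ ^ 2 = 1) (hz₂ : z₂ ^ 2 = 1) (N : ℕ) :
    doublePolylogPartialSum (a + 1) (b + 1) z₁ z₂ N =
      parityFormula (truncatedPolylog N) (a + 1) (b + 1) z₁ z₂ +
        (-1) ^ (a + 1) / 2 *
          (cornerSum (a + 1) (b + 1) z₁ z₂ N - cornerError a b z₁ z₂ N) := by
  have h₁ := sum_lattice_eq_sum_shiftedSum a b hz₁ hz₂ N
  rw [sum_shiftedSum_eq a b hodd hz₁ hz₂] at h₁
  have h₂ := doublePolylogPartialSum_add_swap (a + 1) (b + 1) z₁ z₂ N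
  have ht : ∀ n z, truncatedPolylog N (n + 1) z = polylogPartialSum (n + 1) z N :=
    fun n z => if_neg (by omega)
  rw [parityFormula, Nat.add_sub_cancel, Nat.add_sub_cancel, ht, ht,
    show a + 1 + (b + 1) = a + 1 + b + 1 by ring, ht]
  rw [show a + 1 + (b + 1) = a + 1 + b + 1 by ring] at h₁ h₂
  -- Half of `h₂` plus `(-1) ^ (a + 1) / 2` times `h₁` eliminates the swapped double sum. The two
  -- half-products add when `n₂` is even and cancel when it is odd, whence `δ`.
  rcases Nat.even_or_odd a with ha | ha
  · have hb : Odd b := (Nat.odd_add.mp (add_comm a b ▸ hodd)).mpr ha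
    rw [ha.add_one.neg_one_pow, hb.add_one.neg_one_pow] at h₁
    rw [ha.add_one.neg_one_pow, if_pos hb.add_one]
    linear_combination (-1 / 2) * h₁ + (1 / 2) * h₂
  · have hb : Even b := (Nat.odd_add.mp hodd).mp ha
    rw [ha.add_one.neg_one_pow, hb.add_one.neg_one_pow] at h₁
    rw [ha.add_one.neg_one_pow, if_neg (Nat.not_even_iff_odd.mpr hb.add_one)]
    linear_combination (1 / 2) * h₁ + (1 / 2) * h₂

lemma tendsto_cornerError {a b : ℕ} (hab : 1 ≤ a + b) {z₁ z₂ : ℂ} (hz₁ : ‖z₁‖ = 1)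
    (hz₂ : ‖z₂‖ = 1) : Tendsto (cornerError a b z₁ z₂) atTop (𝓝 0) := by
  have hz : ‖z₁ * z₂‖ = 1 := by rw [norm_mul, hz₁, hz₂, one_mul]
  have : Tendsto (cornerError a b z₁ z₂) atTop
      (𝓝 (∑ j ∈ Finset.range (a + b + 1), (-1) ^ (a + b + 1 - j) *
        ((j.choose a : ℂ) * 0 + (j.choose b : ℂ) * 0))) := by
    refine tendsto_finsetSum _ fun j hj => ?_
    rw [Finset.mem_range] at hj
    exact (((tendsto_cornerSum (by omega) (by omega) (by omega) hz₁ hz).const_mul _).add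
      ((tendsto_cornerSum (by omega) (by omega) (by omega) hz₂ hz).const_mul _)).const_mul _
  simpa using this

lemma tendsto_doublePolylogPartialSum (n₁ n₂ : ℕ) (hn₁ : 1 ≤ n₁) (hn₂ : 1 ≤ n₂)
    (hodd : Odd (n₁ + n₂)) (z₁ z₂ : ℂ) (hz₁ : z₁ = 1 ∨ z₁ = -1) (hz₂ : z₂ = 1 ∨ z₂ = -1)
    (hconv : ¬ (n₂ = 1 ∧ z₂ = 1)) (c : ℂ) :
    Tendsto (doublePolylogPartialSum n₁ n₂ z₁ z₂) atTop
      (𝓝 (parityFormula (signPolylog c) n₁ n₂ z₁ z₂)) := by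
  classical
  have hsign : ∀ z, z = z₁ ∨ z = z₂ ∨ z = z₁ * z₂ → z = 1 ∨ z = -1 := by
    rintro z (rfl | rfl | rfl)
    · exact hz₁
    · exact hz₂
    · rcases hz₁ with rfl | rfl <;> rcases hz₂ with rfl | rfl <;> simp
  -- Replacing the divergent partial sums of `Li_1(1)` by the constant `c` does not change the
  -- truncated formula, and then every entry converges.
  let L : ℕ → ℕ → ℂ → ℂ := fun N n z => if n = 1 ∧ z = 1 then c else truncatedPolylog N n z
  have hlim : Tendsto (fun N => parityFormula (L N) n₁ n₂ z₁ z₂) atTop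
      (𝓝 (parityFormula (signPolylog c) n₁ n₂ z₁ z₂)) := by
    refine tendsto_parityFormula fun n z hz => ?_
    by_cases h0 : n = 0
    · simp [L, truncatedPolylog, signPolylog, h0]
    by_cases h1 : n = 1 ∧ z = 1
    · simp [L, signPolylog, h1]
    · simp only [L, truncatedPolylog, signPolylog, if_neg h0, if_neg h1]
      exact tendsto_polylogPartialSum (by omega) (hsign z hz) h1
  obtain ⟨a, rfl⟩ := Nat.exists_eq_add_of_le' hn₁
  obtain ⟨b, rfl⟩ := Nat.exists_eq_add_of_le' hn₂
  have hab : Odd (a + b) := by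
    rcases hodd with ⟨r, hr⟩
    exact ⟨r - 1, by omega⟩
  have hsq : ∀ {z : ℂ}, z = 1 ∨ z = -1 → z ^ 2 = 1 := by
    rintro z (rfl | rfl) <;> norm_num
  have hnorm : ∀ {z : ℂ}, z = 1 ∨ z = -1 → ‖z‖ = 1 := by
    rintro z (rfl | rfl) <;> simp
  have herr := ((tendsto_cornerSum (a := a + 1) (b := b + 1) (by omega) (by omega)
    (by have := hab.pos; omega) (hnorm hz₁) (hnorm hz₂)).sub
      (tendsto_cornerError hab.pos (hnorm hz₁) (hnorm hz₂))).const_mul ((-1) ^ (a + 1) / 2)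
  have htot := hlim.add herr
  rw [sub_zero, mul_zero, add_zero] at htot
  refine htot.congr fun N => ?_
  rw [doublePolylogPartialSum_eq_parityFormula a b hab (hsq hz₁) (hsq hz₂),
    parityFormula_congr (L := L N) (L' := truncatedPolylog N) (fun n z h => if_neg h) hn₁ hn₂ hodd
      hconv]

end ParityFormula

theorem mainTheorem8 (n₁ n₂ : ℕ) (hn₁ : 1 ≤ n₁) (hn₂ : 1 ≤ n₂) (hodd : Odd (n₁ + n₂))
    (z₁ z₂ : ℂ) (hz₁ : z₁ = 1 ∨ z₁ = -1) (hz₂ : z₂ = 1 ∨ z₂ = -1)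
    (hconv : ¬ (n₂ = 1 ∧ z₂ = 1)) :
    (∀ (k : ℕ) (ζ : ℂ), 1 ≤ k → (ζ = 1 ∨ ζ = -1) → ¬ (k = 1 ∧ ζ = 1) →
      Tendsto (polylogPartialSum k ζ) atTop (𝓝 (polylog k ζ))) ∧
    Tendsto (doublePolylogPartialSum n₁ n₂ z₁ z₂) atTop (𝓝 (doublePolylog n₁ n₂ z₁ z₂)) ∧
    ∀ c : ℂ,
      doublePolylog n₁ n₂ z₁ z₂ =
        (-1 : ℂ) ^ n₁ *
          (∑ p ∈ (Finset.HasAntidiagonal.antidiagonal (n₁ + n₂)).filter (fun p => Even p.1),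
            signPolylog c p.1 (z₁ * z₂) *
              (((p.2 - 1).choose (n₁ - 1) : ℂ) * signPolylog c p.2 z₁ +
                ((p.2 - 1).choose (n₂ - 1) : ℂ) * signPolylog c p.2 z₂)) -
        (1 / 2 : ℂ) * signPolylog c (n₁ + n₂) (z₁ * z₂) +
        signPolylog c n₁ z₁ * signPolylog c n₂ z₂ * (if Even n₂ then 1 else 0) := by
  have h := tendsto_doublePolylogPartialSum n₁ n₂ hn₁ hn₂ hodd z₁ z₂ hz₁ hz₂ hconv
  exact ⟨fun k ζ hk hζ hkζ => tendsto_polylogPartialSum hk hζ hkζ,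
    tendsto_nhds_limUnder ⟨_, h 0⟩, fun c => (h c).limUnder_eq⟩
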